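/- Let $1\le N_A\le N_B$ be integers. Let $A_0\le\dots\le A_{N_A-1}$ and $B_0\le\dots\le B_{N_B-1}$ be real numbers, $(|A_i\rangle)$ and $(|B_j\rangle)$ orthonormal bases of $\mathbb C^{N_A}$ and $\mathbb C^{N_B}$, $H_A=\sum_i A_i|A_i\rangle\langle A_i|$, $H_B=\sum_j B_j|B_j\rangle\langle B_j|$, and $H=H_A\otimes 1+1\otimes H_B$. For a unit vector $|\psi\rangle\in\mathbb C^{N_A}\otimes\mathbb C^{N_B}$, its energy is $\langle\psi|H|\psi\rangle$ and its entropy of entanglement is $S(\mathrm{Tr}_B|\psi\rangle\langle\psi|)$, where $S(\rho)=-\mathrm{Tr}(\rho\ln\rho)$. Fix $\mathcal E\in[0,\ln N_A]$ and let $\mathcal S_{\mathcal E}$ be the set of unit vectors whose entropy of entanglement equals $\mathcal E$. For $0\le i<N_A$ put $E_i=A_i+B_i$ and $E^{*}_i=A_i+B_{i+N_B-N_A}$. Let $d_g$ be the number of indices $i$ at which $E_i$ is minimal, and $d_e$ the number of indices $i$ at which $E^{*}_i$ is maximal. Put $Z_g(\beta)=\sum_{i=0}^{N_A-1}e^{-\beta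 E_i}$ and $Z_e(\beta')=\sum_{i=0}^{N_A-1}e^{\beta' E^{*}_i}$. 1. If $\mathcal E>\ln d_g$, then the equation $(1-\beta\,\partial_\beta)\ln Z_g=\mathcal E$ has exactly one solution $\beta\ge 0$. For this $\beta$, the vector $|\psi_g\rangle=\frac1{\sqrt{Z_g}}\sum_{i=0}^{N_A-1}e^{-\beta E_i/2}|A_iB_i\rangle$ belongs to $\mathcal S_{\mathcal E}$ and minimizes the energy on $\mathcal S_{\mathcal E}$, and its energy is $E_{\min}=-\partial_\beta\ln Z_g$. 2. If $\mathcal E\le\ln d_g$, then the minimum of the energy on $\mathcal S_{\mathcal E}$ exists and equals the lowest eigenvalue $A_0+B_0$ of $H$. The set $\mathcal S_{\mathcal E}$ contains a vector of the span of the $|A_iB_i\rangle$ with $E_i$ minimal, and every minimizer is an eigenvector of $H$ for the eigenvalue $A_0+B_0$. 3. If $\mathcal E>\ln d_e$, then the equation $(1-\beta'\,\partial_{\beta'})\ln Z_e=\mathcal E$ has exactly one solution $\beta'\ge 0$. For this $\beta'$, the vector $|\psi_e\rangle=\frac1{\sqrt{Z_e}}\sum_{i=0}^{N_A-1}e^{\beta'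 E^{*}_i/2}|A_iB_{i+N_B-N_A}\rangle$ belongs to $\mathcal S_{\mathcal E}$ and maximizes the energy on $\mathcal S_{\mathcal E}$, and its energy is $E_{\max}=\partial_{\beta'}\ln Z_e$. 4. If $\mathcal E\le\ln d_e$, then the maximum of the energy on $\mathcal S_{\mathcal E}$ exists and equals the highest eigenvalue $A_{N_A-1}+B_{N_B-1}$ of $H$. The set $\mathcal S_{\mathcal E}$ contains a vector of the span of the $|A_iB_{i+N_B-N_A}\rangle$ with $E^{*}_i$ maximal, and every maximizer is an eigenvector of $H$ for the eigenvalue $A_{N_A-1}+B_{N_B-1}$. -/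

import Mathlib

namespace EnergyBounds

noncomputable section

/-- Kets of a system whose orthonormal reference basis is indexed by `ι`, that is `ℂ^ι`. -/
abbrev Ket (ι : Type) [Fintype ι] : Type := EuclideanSpace ℂ ι

/-- The operator `|ψ⟩⟨ψ|`. -/
def ketBra {ι : Type} [Fintype ι] (ψ : Ket ι) : Matrix ι ι ℂ :=
  Matrix.vecMulVec (fun i => ψ i) (fun i => star (ψ i))

/-- The product ket `|φ⟩ ⊗ |χ⟩` of the bipartite system. -/
def prodKet {ι κ : Type} [Fintype ι] [Fintype κ] (φ : Ket ι) (χ : Ket κ) : Ket (ι × κ) :=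
  WithLp.toLp 2 (fun p => φ p.1 * χ p.2)

/-- The Hamiltonian `∑ n, X n |x n⟩⟨x n|` with eigenvalues `X` and orthonormal eigenbasis `x`. -/
def hamiltonian {N : ℕ} (X : Fin N → ℝ) (x : OrthonormalBasis (Fin N) ℂ (Ket (Fin N))) :
    Matrix (Fin N) (Fin N) ℂ :=
  ∑ n, (X n : ℂ) • ketBra (x n)

/-- The total local Hamiltonian `H_A ⊗ 1 + 1 ⊗ H_B`. -/
def totalHamiltonian {ι κ : Type} [DecidableEq ι] [DecidableEq κ]
    (HA : Matrix ι ι ℂ) (HB : Matrix κ κ ℂ) : Matrix (ι × κ) (ι × κ) ℂ :=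
  Matrix.kronecker HA (1 : Matrix κ κ ℂ) + Matrix.kronecker (1 : Matrix ι ι ℂ) HB

/-- The mean energy `⟨ψ|H|ψ⟩` (a real number when `H` is Hermitian). -/
def energy {ι : Type} [Fintype ι] (H : Matrix ι ι ℂ) (ψ : Ket ι) : ℝ :=
  (dotProduct (fun i => star (ψ i)) (Matrix.mulVec H (fun i => ψ i))).re

/-- The partial trace over the second subsystem. -/
def partialTraceB {ι κ : Type} [Fintype κ] (ρ : Matrix (ι × κ) (ι × κ) ℂ) : Matrix ι ι ℂ :=
  Matrix.of fun i i' => ∑ j, ρ (i, j) (i', j)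

/-- The von Neumann entropy `-Tr(ρ ln ρ)`, with `ln ρ` given by the functional calculus of Hermitian
matrices (`Real.log 0 = 0`, so the convention `0 ln 0 = 0` is respected). -/
def vonNeumannEntropy {ι : Type} [Fintype ι] [DecidableEq ι] (ρ : Matrix ι ι ℂ) : ℝ :=
  -(Matrix.trace (ρ * cfc Real.log ρ)).re

/-- The entropy of entanglement of a pure state: the entropy of its reduced state. -/
def entanglementEntropy {ι κ : Type} [Fintype ι] [DecidableEq ι] [Fintype κ]
    (ψ : Ket (ι × κ)) : ℝ :=
  vonNeumannEntropy (partialTraceB (ketBra ψ))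

/-- The pure states (unit vectors) with entropy of entanglement `S`. -/
def pureStates (ι κ : Type) [Fintype ι] [DecidableEq ι] [Fintype κ] (S : ℝ) : Set (Ket (ι × κ)) :=
  {ψ | ‖ψ‖ = 1 ∧ entanglementEntropy ψ = S}

/-- `ψ` lies in the eigenspace of `H` for the eigenvalue `E`. -/
def InEigenspace {ι : Type} [Fintype ι] (H : Matrix ι ι ℂ) (E : ℝ) (ψ : Ket ι) : Prop :=
  Matrix.mulVec H (fun i => ψ i) = (E : ℂ) • (fun i => ψ i)

/-- The shifted index `i + (N_B - N_A)`. -/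
def shift {NA NB : ℕ} (h : NA ≤ NB) (i : Fin NA) : Fin NB :=
  ⟨i.val + (NB - NA), by have := i.isLt; omega⟩

/-- The energies `E_i = A_i + B_i`, for `i < N_A`. -/
def lowE {NA NB : ℕ} (h : NA ≤ NB) (A : Fin NA → ℝ) (B : Fin NB → ℝ) (i : Fin NA) : ℝ :=
  A i + B (Fin.castLE h i)

/-- The energies `A_i + B_{i + N_B - N_A}`, for `i < N_A`. -/
def highE {NA NB : ℕ} (h : NA ≤ NB) (A : Fin NA → ℝ) (B : Fin NB → ℝ) (i : Fin NA) : ℝ :=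
  A i + B (shift h i)

/-- The number `d_g` of indices at which `E` is minimal. -/
def groundDegeneracy {N : ℕ} (E : Fin N → ℝ) : ℕ := Nat.card {i : Fin N // ∀ j, E i ≤ E j}

/-- The number `d_e` of indices at which `E` is maximal. -/
def topDegeneracy {N : ℕ} (E : Fin N → ℝ) : ℕ := Nat.card {i : Fin N // ∀ j, E j ≤ E i}

/-- `Z_g(β) = ∑ i, exp (-β E_i)`. -/
def Zg {N : ℕ} (E : Fin N → ℝ) (β : ℝ) : ℝ := ∑ i, Real.exp (-β * E i)

/-- `Z_e(β') = ∑ i, exp (β' E_i)`. -/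
def Ze {N : ℕ} (E : Fin N → ℝ) (β : ℝ) : ℝ := ∑ i, Real.exp (β * E i)

/-- `(1 - β ∂_β) ln Z`, as a function of `β`. -/
def thermalEntropy (Z : ℝ → ℝ) (β : ℝ) : ℝ :=
  Real.log (Z β) - β * deriv (fun b => Real.log (Z b)) β

/-- `(1/√Z_g) ∑ i, exp (-β (A_i + B_i) / 2) |A_i B_i⟩`. -/
def psiG {NA NB : ℕ} (h : NA ≤ NB) (A : Fin NA → ℝ) (B : Fin NB → ℝ)
    (a : OrthonormalBasis (Fin NA) ℂ (Ket (Fin NA)))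
    (b : OrthonormalBasis (Fin NB) ℂ (Ket (Fin NB))) (β : ℝ) : Ket (Fin NA × Fin NB) :=
  ((1 / Real.sqrt (Zg (lowE h A B) β) : ℝ) : ℂ) •
    ∑ i, ((Real.exp (-β / 2 * lowE h A B i) : ℝ) : ℂ) • prodKet (a i) (b (Fin.castLE h i))

/-- `(1/√Z_e) ∑ i, exp (β' (A_i + B_{i+Δ}) / 2) |A_i B_{i+Δ}⟩`, with `Δ = N_B - N_A`. -/
def psiE {NA NB : ℕ} (h : NA ≤ NB) (A : Fin NA → ℝ) (B : Fin NB → ℝ)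
    (a : OrthonormalBasis (Fin NA) ℂ (Ket (Fin NA)))
    (b : OrthonormalBasis (Fin NB) ℂ (Ket (Fin NB))) (β : ℝ) : Ket (Fin NA × Fin NB) :=
  ((1 / Real.sqrt (Ze (highE h A B) β) : ℝ) : ℂ) •
    ∑ i, ((Real.exp (β / 2 * highE h A B i) : ℝ) : ℂ) • prodKet (a i) (b (shift h i))

end

end EnergyBounds

namespace EnergyBounds

/-! ### Product kets and local Hamiltonians -/

section Bipartite

variable {ι κ τ : Type} [Fintype ι] [Fintype κ]

/-! A Schmidt decomposition (`exists_schmidt`) writes `ψ = ∑ k, √(p k) |u k⟩|v k⟩` with `p`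
decreasing. The entropy of entanglement is then the Shannon entropy of `p`. Since `H` is local, the
energy is the `p`-average of `⟨u k|H_A|u k⟩ + ⟨v k|H_B|v k⟩`. Squared overlaps of orthonormal bases
are doubly stochastic, so Birkhoff's theorem and the rearrangement inequality bound this average
below by `∑ k, p k * E k` (`sum_mul_le_energy_schmidtKet`), with equality on the Schmidt kets built
from the `|A_k B_k⟩`.

What remains is classical: minimise `∑ p E` at given Shannon entropy. The Gibbs variational
principle `S ≤ β U + ln Z` (`sum_negMulLog_le`), an equality at the Gibbs weights, settles it once
`β` has the right entropy. Such a `β` exists and is unique because the thermal entropy is continuous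
and injective on `β ≥ 0`, starts at `ln N_A` and tends to `ln d_g`
(`existsUnique_thermalEntropy_Zg`). For `S ≤ ln d_g`, weights supported on the ground indices
already realise `S` (`exists_weights_entropy`).

The statements on the maximum are those on the minimum for `-H`, with both spectra negated and
reversed. -/

lemma inner_ket (φ χ : Ket ι) : inner ℂ φ χ = ∑ i, star (φ i) * χ i := by
  simp [PiLp.inner_apply, mul_comm]

lemma inner_prodKet (φ φ' : Ket ι) (χ χ' : Ket κ) :
    inner ℂ (prodKet φ χ) (prodKet φ' χ') = inner ℂ φ φ' * inner ℂ χ χ' := by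
  simp only [inner_ket, prodKet, Fintype.sum_prod_type, Finset.sum_mul_sum, star_mul']
  refine Finset.sum_congr rfl fun i _ => Finset.sum_congr rfl fun j _ => ?_
  ring

lemma orthonormal_prodKet {u : τ → Ket ι} {v : τ → Ket κ} (hu : Orthonormal ℂ u)
    (hv : Orthonormal ℂ v) : Orthonormal ℂ fun k => prodKet (u k) (v k) := by
  classical
  rw [orthonormal_iff_ite] at *
  intro k l
  rw [inner_prodKet, hu, hv]
  split_ifs <;> simp

/-- The product of two orthonormal bases. -/
lemma exists_prodBasis [DecidableEq ι] [DecidableEq κ] (a : OrthonormalBasis ι ℂ (Ket ι))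
    (b : OrthonormalBasis κ ℂ (Ket κ)) :
    ∃ e : OrthonormalBasis (ι × κ) ℂ (Ket (ι × κ)), ∀ p, e p = prodKet (a p.1) (b p.2) := by
  have h : Orthonormal ℂ (Set.univ.domRestrict
      fun p : ι × κ => prodKet (a p.1) (b p.2)) := by
    rw [orthonormal_iff_ite]
    rintro ⟨⟨i, j⟩, _⟩ ⟨⟨i', j'⟩, _⟩
    simp only [Set.domRestrict_apply, inner_prodKet, orthonormal_iff_ite.1 a.orthonormal,
      orthonormal_iff_ite.1 b.orthonormal, Subtype.mk.injEq, Prod.mk.injEq]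
    by_cases h1 : i = i' <;> by_cases h2 : j = j' <;> simp [h1, h2]
  obtain ⟨e, he⟩ := h.exists_orthonormalBasis_extension_of_card_eq (by simp)
  exact ⟨e, fun p => he p (Set.mem_univ p)⟩

lemma ketBra_mulVec (φ ψ : Ket ι) :
    (ketBra φ).mulVec (fun i => ψ i) = fun i => inner ℂ φ ψ * φ i := by
  ext i
  simp only [Matrix.mulVec, dotProduct, ketBra, Matrix.vecMulVec_apply, inner_ket, Finset.sum_mul]
  exact Finset.sum_congr rfl fun j _ => by ring

lemma hamiltonian_mulVec_basis {N : ℕ} (X : Fin N → ℝ)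
    (x : OrthonormalBasis (Fin N) ℂ (Ket (Fin N))) (n i : Fin N) :
    (hamiltonian X x).mulVec (fun i => x n i) i = X n * x n i := by
  simp only [hamiltonian, Matrix.sum_mulVec, Matrix.smul_mulVec, ketBra_mulVec,
    orthonormal_iff_ite.1 x.orthonormal, Finset.sum_apply, Pi.smul_apply, smul_eq_mul]
  simp

lemma totalHamiltonian_mulVec_prodKet [DecidableEq ι] [DecidableEq κ] (HA : Matrix ι ι ℂ)
    (HB : Matrix κ κ ℂ) (φ : Ket ι) (χ : Ket κ) (p : ι × κ) :
    (totalHamiltonian HA HB).mulVec (fun q => prodKet φ χ q) p =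
      HA.mulVec (fun i => φ i) p.1 * χ p.2 + φ p.1 * HB.mulVec (fun j => χ j) p.2 := by
  rw [totalHamiltonian, Matrix.add_mulVec, Pi.add_apply]
  simp only [Matrix.mulVec, dotProduct, Fintype.sum_prod_type, Matrix.kronecker,
    Matrix.kroneckerMap_apply, prodKet, Matrix.one_apply, Finset.sum_mul, Finset.mul_sum]
  congr 1
  · refine Finset.sum_congr rfl fun i _ => ?_
    simp [mul_assoc]
  · simp [mul_left_comm]

end Bipartite

/-! ### Energy in an eigenbasis -/

section Eigenbasis

variable {ι : Type} [Fintype ι] {H : Matrix ι ι ℂ} {E : ι → ℝ} {e : OrthonormalBasis ι ℂ (Ket ι)}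

lemma mulVec_eq_sum (he : ∀ k, H.mulVec (fun i => e k i) = fun i => E k * e k i) (ψ : Ket ι) :
    H.mulVec (fun i => ψ i) = fun i => ∑ k, E k * inner ℂ (e k) ψ * e k i := by
  have h : (fun i => ψ i) = ∑ k, inner ℂ (e k) ψ • fun i => e k i := by
    ext i
    conv_lhs => rw [← e.sum_repr' ψ]
    simp
  rw [h, Matrix.mulVec_sum]
  ext i
  simp only [Finset.sum_apply, Matrix.mulVec_smul, he, Pi.smul_apply, smul_eq_mul]
  exact Finset.sum_congr rfl fun k _ => by ring

lemma energy_eq_sum (he : ∀ k, H.mulVec (fun i => e k i) = fun i => E k * e k i) (ψ : Ket ι) :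
    energy H ψ = ∑ k, E k * ‖inner ℂ (e k) ψ‖ ^ 2 := by
  have h : dotProduct (fun i => star (ψ i)) (H.mulVec fun i => ψ i) =
      ∑ k, ((E k * ‖inner ℂ (e k) ψ‖ ^ 2 : ℝ) : ℂ) := by
    simp only [mulVec_eq_sum he, dotProduct, Finset.mul_sum]
    rw [Finset.sum_comm]
    refine Finset.sum_congr rfl fun k _ => ?_
    have : ∑ i, star (ψ i) * (E k * inner ℂ (e k) ψ * e k i) =
        E k * inner ℂ (e k) ψ * inner ℂ ψ (e k) := by
      rw [inner_ket ψ, Finset.mul_sum]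
      exact Finset.sum_congr rfl fun i _ => by ring
    rw [this, mul_assoc, ← inner_conj_symm ψ (e k), Complex.mul_conj, Complex.normSq_eq_norm_sq]
    push_cast
    rfl
  rw [energy, h, ← Complex.ofReal_sum, Complex.ofReal_re]

lemma le_energy (he : ∀ k, H.mulVec (fun i => e k i) = fun i => E k * e k i) {E₀ : ℝ}
    (hE : ∀ k, E₀ ≤ E k) {ψ : Ket ι} (hψ : ‖ψ‖ = 1) : E₀ ≤ energy H ψ := by
  have h := e.sum_sq_norm_inner_right ψ
  rw [hψ, one_pow] at h
  rw [energy_eq_sum he, ← mul_one E₀, ← h, Finset.mul_sum]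
  gcongr with k
  exact hE k

/-- The excess energy is `∑ (E k - E₀) |⟨e k, ψ⟩|²`, a sum of nonnegative terms. If it vanishes, `ψ`
has no component on any `e k` with `E k ≠ E₀`. -/
lemma inEigenspace_of_energy_eq (he : ∀ k, H.mulVec (fun i => e k i) = fun i => E k * e k i)
    {E₀ : ℝ} (hE : ∀ k, E₀ ≤ E k) {ψ : Ket ι} (hψ : ‖ψ‖ = 1) (h : energy H ψ = E₀) :
    InEigenspace H E₀ ψ := by
  have h1 := e.sum_sq_norm_inner_right ψ
  rw [hψ, one_pow] at h1
  have h2 : ∑ k, (E k - E₀) * ‖inner ℂ (e k) ψ‖ ^ 2 = 0 := by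
    simp only [sub_mul, Finset.sum_sub_distrib, ← Finset.mul_sum]
    rw [← energy_eq_sum he, h, h1]
    ring
  rw [Finset.sum_eq_zero_iff_of_nonneg fun k _ => mul_nonneg (sub_nonneg.2 (hE k)) (sq_nonneg _)]
    at h2
  have h3 : ∀ k, (E k : ℂ) * inner ℂ (e k) ψ = E₀ * inner ℂ (e k) ψ := by
    intro k
    rcases mul_eq_zero.1 (h2 k (Finset.mem_univ k)) with h | h
    · rw [sub_eq_zero.1 h]
    · rw [norm_eq_zero.1 (pow_eq_zero_iff two_ne_zero |>.1 h), mul_zero, mul_zero]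
  rw [InEigenspace, mulVec_eq_sum he]
  ext i
  conv_rhs => rw [← e.sum_repr' ψ]
  simp [h3, Finset.mul_sum, mul_assoc]

end Eigenbasis

lemma exists_totalHamiltonian_eigenbasis {NA NB : ℕ} (A : Fin NA → ℝ) (B : Fin NB → ℝ)
    (a : OrthonormalBasis (Fin NA) ℂ (Ket (Fin NA)))
    (b : OrthonormalBasis (Fin NB) ℂ (Ket (Fin NB))) :
    ∃ e : OrthonormalBasis (Fin NA × Fin NB) ℂ (Ket (Fin NA × Fin NB)),
      (∀ p, e p = prodKet (a p.1) (b p.2)) ∧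
      ∀ p, (totalHamiltonian (hamiltonian A a) (hamiltonian B b)).mulVec (fun q => e p q) =
        fun q => ((A p.1 + B p.2 : ℝ) : ℂ) * e p q := by
  obtain ⟨e, he⟩ := exists_prodBasis a b
  refine ⟨e, he, fun p => ?_⟩
  ext q
  rw [he, totalHamiltonian_mulVec_prodKet, hamiltonian_mulVec_basis, hamiltonian_mulVec_basis,
    prodKet]
  push_cast
  ring

/-! ### Schmidt form -/

section Schmidt

variable {ι κ τ : Type} [Fintype ι] [Fintype κ] [Fintype τ]

/-- The ket `∑ k, c k |u k⟩|v k⟩`. -/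
noncomputable def schmidtKet (c : τ → ℝ) (u : τ → Ket ι) (v : τ → Ket κ) : Ket (ι × κ) :=
  ∑ k, (c k : ℂ) • prodKet (u k) (v k)

lemma norm_sq_sum_smul_orthonormal {V : Type*} [NormedAddCommGroup V] [InnerProductSpace ℂ V]
    {v : τ → V} (hv : Orthonormal ℂ v) (c : τ → ℂ) :
    ‖∑ k, c k • v k‖ ^ 2 = ∑ k, ‖c k‖ ^ 2 := by
  have h : inner ℂ (∑ k, c k • v k) (∑ k, c k • v k) = ((∑ k, ‖c k‖ ^ 2 : ℝ) : ℂ) := by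
    rw [hv.inner_sum]
    push_cast
    exact Finset.sum_congr rfl fun k _ => Complex.conj_mul' _
  rw [@norm_sq_eq_re_inner ℂ, h]
  exact Complex.ofReal_re _

lemma norm_sq_schmidtKet (c : τ → ℝ) {u : τ → Ket ι} {v : τ → Ket κ} (hu : Orthonormal ℂ u)
    (hv : Orthonormal ℂ v) : ‖schmidtKet c u v‖ ^ 2 = ∑ k, c k ^ 2 := by
  rw [schmidtKet, norm_sq_sum_smul_orthonormal (orthonormal_prodKet hu hv)]
  simp

lemma partialTraceB_schmidtKet (c : τ → ℝ) (u : τ → Ket ι) {v : τ → Ket κ}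
    (hv : Orthonormal ℂ v) :
    partialTraceB (ketBra (schmidtKet c u v)) = ∑ k, ((c k ^ 2 : ℝ) : ℂ) • ketBra (u k) := by
  classical
  ext i i'
  have h : ∀ (i : ι) (j : κ), schmidtKet c u v (i, j) = ∑ k, c k * u k i * v k j := by
    intro i j
    simp [schmidtKet, prodKet, mul_assoc]
  have h' : ∀ k l, ∑ j, v k j * star (v l j) = if k = l then 1 else 0 := by
    intro k l
    simp only [eq_comm (a := k), ← orthonormal_iff_ite.1 hv l k, inner_ket]
    exact Finset.sum_congr rfl fun j _ => mul_comm _ _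
  simp only [partialTraceB, ketBra, Matrix.of_apply, Matrix.vecMulVec_apply, h, Matrix.sum_apply,
    Matrix.smul_apply, star_sum, Finset.sum_mul_sum]
  rw [Finset.sum_comm]
  refine Finset.sum_congr rfl fun k _ => ?_
  rw [Finset.sum_comm]
  have : ∀ l, ∑ j, c k * u k i * v k j * star (c l * u l i' * v l j) =
      c k * u k i * star (c l * u l i') * if k = l then 1 else 0 := by
    intro l
    rw [← h', Finset.mul_sum]
    exact Finset.sum_congr rfl fun j _ => by rw [star_mul']; ring
  simp only [this]
  simp
  ring

/-- By Parseval in `b`, the left side is the squared norm of `⟨φ|` contracted with the first factor,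
a combination of the orthonormal `v k`. This is the marginal weight of `φ`, all that a local
Hamiltonian sees. -/
lemma sum_norm_sq_inner_schmidtKet_left (c : τ → ℝ) (u : τ → Ket ι) {v : τ → Ket κ}
    (hv : Orthonormal ℂ v) (φ : Ket ι) (b : OrthonormalBasis κ ℂ (Ket κ)) :
    ∑ j, ‖inner ℂ (prodKet φ (b j)) (schmidtKet c u v)‖ ^ 2 =
      ∑ k, c k ^ 2 * ‖inner ℂ φ (u k)‖ ^ 2 := by
  have h : ∀ j, inner ℂ (prodKet φ (b j)) (schmidtKet c u v) =
      inner ℂ (b j) (∑ k, (c k * inner ℂ φ (u k)) • v k) := by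
    intro j
    simp [schmidtKet, inner_prodKet, mul_assoc]
  simp only [h]
  rw [b.sum_sq_norm_inner_right, norm_sq_sum_smul_orthonormal hv]
  simp [mul_pow]

lemma sum_norm_sq_inner_schmidtKet_right (c : τ → ℝ) {u : τ → Ket ι} (v : τ → Ket κ)
    (hu : Orthonormal ℂ u) (χ : Ket κ) (a : OrthonormalBasis ι ℂ (Ket ι)) :
    ∑ i, ‖inner ℂ (prodKet (a i) χ) (schmidtKet c u v)‖ ^ 2 =
      ∑ k, c k ^ 2 * ‖inner ℂ χ (v k)‖ ^ 2 := by
  have h : ∀ i, inner ℂ (prodKet (a i) χ) (schmidtKet c u v) =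
      inner ℂ (a i) (∑ k, (c k * inner ℂ χ (v k)) • u k) := by
    intro i
    simp only [schmidtKet, inner_sum, inner_smul_right, inner_prodKet]
    exact Finset.sum_congr rfl fun k _ => by ring
  simp only [h]
  rw [a.sum_sq_norm_inner_right, norm_sq_sum_smul_orthonormal hu]
  simp [mul_pow]

end Schmidt

lemma energy_schmidtKet {NA NB : ℕ} {τ : Type} [Fintype τ] (A : Fin NA → ℝ) (B : Fin NB → ℝ)
    (a : OrthonormalBasis (Fin NA) ℂ (Ket (Fin NA)))
    (b : OrthonormalBasis (Fin NB) ℂ (Ket (Fin NB))) (c : τ → ℝ)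
    {u : τ → Ket (Fin NA)} {v : τ → Ket (Fin NB)} (hu : Orthonormal ℂ u) (hv : Orthonormal ℂ v) :
    energy (totalHamiltonian (hamiltonian A a) (hamiltonian B b)) (schmidtKet c u v) =
      ∑ k, c k ^ 2 * ∑ i, A i * ‖inner ℂ (a i) (u k)‖ ^ 2 +
      ∑ k, c k ^ 2 * ∑ j, B j * ‖inner ℂ (b j) (v k)‖ ^ 2 := by
  obtain ⟨e, he, hH⟩ := exists_totalHamiltonian_eigenbasis A B a b
  rw [energy_eq_sum hH]
  simp only [he, add_mul, Finset.sum_add_distrib, Fintype.sum_prod_type]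
  congr 1
  · simp only [← Finset.mul_sum, sum_norm_sq_inner_schmidtKet_left c u hv]
    simp only [Finset.mul_sum]
    rw [Finset.sum_comm]
    exact Finset.sum_congr rfl fun k _ => Finset.sum_congr rfl fun i _ => by ring
  · rw [Finset.sum_comm]
    simp only [← Finset.mul_sum, sum_norm_sq_inner_schmidtKet_right c v hu]
    simp only [Finset.mul_sum]
    rw [Finset.sum_comm]
    exact Finset.sum_congr rfl fun k _ => Finset.sum_congr rfl fun i _ => by ring

/-! ### Entropy of a diagonalised density matrix -/

lemma vonNeumannEntropy_eq_sum_eigenvalues {ι : Type} [Fintype ι] [DecidableEq ι] {ρ : Matrix ι ι ℂ}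
    (hρ : ρ.IsHermitian) :
    vonNeumannEntropy ρ = ∑ i, Real.negMulLog (hρ.eigenvalues i) := by
  have h : ρ * cfc Real.log ρ = Unitary.conjStarAlgAut ℂ _ hρ.eigenvectorUnitary
      (Matrix.diagonal fun i => ((hρ.eigenvalues i * Real.log (hρ.eigenvalues i) : ℝ) : ℂ)) := by
    have h1 := hρ.spectral_theorem
    rw [hρ.cfc_eq, Matrix.IsHermitian.cfc]
    conv_lhs => enter [1]; rw [h1]
    rw [← map_mul, Matrix.diagonal_mul_diagonal]
    simp
  rw [vonNeumannEntropy, h, Unitary.conjStarAlgAut_apply, Matrix.trace_mul_comm, ← mul_assoc]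
  simp [Matrix.trace_diagonal, Real.negMulLog]

lemma hamiltonian_apply {N : ℕ} (q : Fin N → ℝ) (a : OrthonormalBasis (Fin N) ℂ (Ket (Fin N)))
    (i j : Fin N) : hamiltonian q a i j = ∑ n, q n * (a n i * star (a n j)) := by
  simp [hamiltonian, ketBra, Matrix.sum_apply, Matrix.vecMulVec_apply]

lemma isHermitian_hamiltonian {N : ℕ} (q : Fin N → ℝ)
    (a : OrthonormalBasis (Fin N) ℂ (Ket (Fin N))) : (hamiltonian q a).IsHermitian := by
  ext i j
  simp only [Matrix.conjTranspose_apply, hamiltonian_apply, star_sum, star_mul', star_star]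
  refine Finset.sum_congr rfl fun n _ => ?_
  rw [mul_comm (a n i)]
  simp

open Polynomial in
lemma charpoly_hamiltonian {N : ℕ} (q : Fin N → ℝ)
    (a : OrthonormalBasis (Fin N) ℂ (Ket (Fin N))) :
    (hamiltonian q a).charpoly = ∏ n, (X - C (q n : ℂ)) := by
  set U : Matrix (Fin N) (Fin N) ℂ := Matrix.of fun i n => a n i
  have hU : U.conjTranspose * U = 1 := by
    ext n m
    simp only [Matrix.mul_apply, U, Matrix.conjTranspose_apply, Matrix.of_apply, ← inner_ket,
      orthonormal_iff_ite.1 a.orthonormal, Matrix.one_apply]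
  have h : hamiltonian q a = U * (Matrix.diagonal (fun n => (q n : ℂ)) * U.conjTranspose) := by
    ext i j
    rw [hamiltonian_apply, Matrix.mul_apply]
    refine Finset.sum_congr rfl fun n _ => ?_
    simp only [U, Matrix.of_apply, Matrix.diagonal_mul, Matrix.conjTranspose_apply]
    ring
  rw [h, Matrix.charpoly_mul_comm, mul_assoc, hU, mul_one, Matrix.charpoly_diagonal]

/-- The entropy depends only on the multiset of eigenvalues, which the roots of the characteristic
polynomial determine. No explicit matching of `q` with `hρ.eigenvalues` is needed. -/
lemma vonNeumannEntropy_hamiltonian {N : ℕ} (q : Fin N → ℝ)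
    (a : OrthonormalBasis (Fin N) ℂ (Ket (Fin N))) :
    vonNeumannEntropy (hamiltonian q a) = ∑ n, Real.negMulLog (q n) := by
  have hρ := isHermitian_hamiltonian q a
  have h := hρ.roots_charpoly_eq_eigenvalues
  rw [charpoly_hamiltonian, Polynomial.roots_prod _ _
    (Finset.prod_ne_zero_iff.2 fun n _ => Polynomial.X_sub_C_ne_zero _)] at h
  simp only [Polynomial.roots_X_sub_C, Multiset.bind_singleton] at h
  replace h := congrArg (fun s => (s.map fun z : ℂ => Real.negMulLog z.re).sum) h
  simp only [Multiset.map_map, Function.comp_def, Complex.ofReal_re] at h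
  rw [vonNeumannEntropy_eq_sum_eigenvalues hρ]
  exact h.symm

lemma entanglementEntropy_schmidtKet {N : ℕ} {κ : Type} [Fintype κ] (c : Fin N → ℝ)
    (u : OrthonormalBasis (Fin N) ℂ (Ket (Fin N))) {v : Fin N → Ket κ} (hv : Orthonormal ℂ v) :
    entanglementEntropy (schmidtKet c u v) = ∑ k, Real.negMulLog (c k ^ 2) := by
  rw [entanglementEntropy, partialTraceB_schmidtKet c u hv]
  exact vonNeumannEntropy_hamiltonian (fun k => c k ^ 2) u

/-! ### Schmidt decomposition -/

/-- The vector `(⟨φ| ⊗ 1) ψ`. -/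
noncomputable def partialInner {ι κ : Type} [Fintype ι] [Fintype κ] (φ : Ket ι) (ψ : Ket (ι × κ)) :
    Ket κ :=
  WithLp.toLp 2 fun j => ∑ i, star (φ i) * ψ (i, j)

lemma sum_prodKet_partialInner {ι κ : Type} [Fintype ι] [Fintype κ]
    (u : OrthonormalBasis ι ℂ (Ket ι)) (ψ : Ket (ι × κ)) :
    ∑ k, prodKet (u k) (partialInner (u k) ψ) = ψ := by
  ext ⟨i, j⟩
  have h := congrArg (fun φ : Ket ι => φ i) (u.sum_repr' (WithLp.toLp 2 fun i => ψ (i, j)))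
  simp only [inner_ket] at h
  simpa [prodKet, partialInner, mul_comm] using h

lemma isHermitian_partialTraceB_ketBra {ι κ : Type} [Fintype ι] [Fintype κ] (ψ : Ket (ι × κ)) :
    (partialTraceB (ketBra ψ)).IsHermitian := by
  ext i j
  simp [partialTraceB, ketBra, Matrix.vecMulVec_apply, mul_comm]

/-- The Gram matrix of the partial inner products is given by the matrix elements of the reduced
state. Contracting `ψ` with an eigenbasis of that state therefore yields orthogonal vectors whose
squared norms are the eigenvalues. -/
lemma inner_partialInner {ι κ : Type} [Fintype ι] [Fintype κ] (φ χ : Ket ι) (ψ : Ket (ι × κ)) :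
    inner ℂ (partialInner φ ψ) (partialInner χ ψ) =
      ∑ i, star (χ i) * (partialTraceB (ketBra ψ)).mulVec (fun i => φ i) i := by
  simp only [inner_ket, partialInner, Matrix.mulVec, dotProduct, partialTraceB, ketBra,
    Matrix.of_apply, Matrix.vecMulVec_apply, star_sum, star_mul', star_star, Finset.mul_sum, Finset.sum_mul]
  rw [Finset.sum_comm]
  refine Finset.sum_congr rfl fun i _ => ?_
  rw [Finset.sum_comm]
  exact Finset.sum_congr rfl fun k _ => Finset.sum_congr rfl fun j _ => by ring

/-- Every ket has a Schmidt decomposition with decreasing weights. -/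
lemma exists_schmidt {NA NB : ℕ} (h : NA ≤ NB) (ψ : Ket (Fin NA × Fin NB)) :
    ∃ (p : Fin NA → ℝ) (u : OrthonormalBasis (Fin NA) ℂ (Ket (Fin NA)))
      (v : OrthonormalBasis (Fin NB) ℂ (Ket (Fin NB))),
      Antitone p ∧ (∀ k, 0 ≤ p k) ∧
      ψ = schmidtKet (fun k => Real.sqrt (p k)) u (fun k => v (Fin.castLE h k)) := by
  set ρ := partialTraceB (ketBra ψ) with hρdef
  have hρ : ρ.IsHermitian := isHermitian_partialTraceB_ketBra ψ
  -- Sorting in the order dual puts the eigenvalues in decreasing order.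
  obtain ⟨σ, hσ⟩ : ∃ σ : Equiv.Perm (Fin NA), Antitone (hρ.eigenvalues ∘ σ) :=
    ⟨Tuple.sort (OrderDual.toDual ∘ hρ.eigenvalues),
      fun i j hij => Tuple.monotone_sort (OrderDual.toDual ∘ hρ.eigenvalues) hij⟩
  set p := hρ.eigenvalues ∘ σ
  set u := hρ.eigenvectorBasis.reindex σ.symm
  have hu : ∀ k, ρ.mulVec (fun i => u k i) = fun i => p k * u k i := by
    intro k
    have := hρ.mulVec_eigenvectorBasis (σ k)
    ext i
    have := congrFun this i
    simpa [u, p] using this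
  set w := fun k => partialInner (u k) ψ
  have hw : ∀ k l, inner ℂ (w k) (w l) = if k = l then (p k : ℂ) else 0 := by
    intro k l
    simp only [w]
    rw [inner_partialInner, ← hρdef, hu]
    have : ∑ i, star (u l i) * (p k * u k i) = p k * inner ℂ (u l) (u k) := by
      rw [inner_ket, Finset.mul_sum]
      exact Finset.sum_congr rfl fun i _ => by ring
    rw [this, orthonormal_iff_ite.1 u.orthonormal]
    by_cases hkl : k = l
    · simp [hkl]
    · simp [hkl, Ne.symm hkl]
  have hp : ∀ k, p k = ‖w k‖ ^ 2 := by
    intro k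
    rw [@norm_sq_eq_re_inner ℂ, hw]
    simp
  have hp0 : ∀ k, 0 ≤ p k := fun k => hp k ▸ sq_nonneg _
  have hws : ∀ k, Real.sqrt (p k) = ‖w k‖ := fun k => by rw [hp, Real.sqrt_sq (norm_nonneg _)]
  -- Only the values on `s`, where `w k ≠ 0`, matter. They are orthonormal, and the extension to a
  -- basis replaces all others; where `w k = 0` the Schmidt weight vanishes, so any vector will do.
  set v₀ : Fin NB → Ket (Fin NB) := fun j =>
    if hj : j.val < NA then ((‖w ⟨j, hj⟩‖⁻¹ : ℝ) : ℂ) • w ⟨j, hj⟩ else 0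
  set s : Set (Fin NB) := {j | ∃ k : Fin NA, w k ≠ 0 ∧ j = Fin.castLE h k}
  have hv₀ : ∀ k, v₀ (Fin.castLE h k) = ((‖w k‖⁻¹ : ℝ) : ℂ) • w k := by
    intro k
    simp [v₀]
  have hon : Orthonormal ℂ (s.domRestrict v₀) := by
    rw [orthonormal_iff_ite]
    rintro ⟨_, k, hk, rfl⟩ ⟨_, l, hl, rfl⟩
    simp only [Set.domRestrict_apply, hv₀, inner_smul_left, inner_smul_right, hw,
      Subtype.mk.injEq, (Fin.castLE_injective h).eq_iff]
    split_ifs with hkl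
    · subst hkl
      have : (‖w k‖ : ℂ) ≠ 0 := by simpa using hk
      rw [hp]
      push_cast
      simp only [map_inv₀, Complex.conj_ofReal]
      field_simp
    · simp
  obtain ⟨v, hv⟩ := hon.exists_orthonormalBasis_extension_of_card_eq (by simp)
  refine ⟨p, u, v, hσ, hp0, ?_⟩
  conv_lhs => rw [← sum_prodKet_partialInner u ψ]
  rw [schmidtKet]
  refine Finset.sum_congr rfl fun k _ => ?_
  have hk : partialInner (u k) ψ = (Real.sqrt (p k) : ℂ) • v (Fin.castLE h k) := by
    change w k = _
    by_cases hk : w k = 0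
    · simp [hws, hk]
    · rw [hv _ ⟨k, hk, rfl⟩, hv₀, hws, smul_smul, ← Complex.ofReal_mul,
        mul_inv_cancel₀ (norm_ne_zero_iff.2 hk)]
      simp
  rw [hk]
  ext q
  simp [prodKet]
  ring

/-! ### Rearrangement -/

/-- By Birkhoff, `M` is a convex combination of permutation matrices, and for each of these the
claim is the rearrangement inequality. -/
lemma sum_mul_le_sum_doublyStochastic {n : ℕ} {p X : Fin n → ℝ} (hp : Antitone p)
    (hX : Monotone X) {M : Matrix (Fin n) (Fin n) ℝ} (hM : M ∈ doublyStochastic ℝ (Fin n)) :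
    ∑ k, p k * X k ≤ ∑ k, p k * ∑ i, X i * M i k := by
  obtain ⟨w, hw0, hw1, rfl⟩ := exists_eq_sum_perm_of_mem_doublyStochastic hM
  have h : ∑ k, p k * ∑ i, X i * (∑ σ, w σ • σ.permMatrix ℝ) i k =
      ∑ σ : Equiv.Perm (Fin n), w σ * ∑ i, p (σ i) * X i := by
    simp only [Matrix.sum_apply, Matrix.smul_apply, Finset.mul_sum, smul_eq_mul]
    rw [Finset.sum_comm]
    conv_lhs => enter [2, i]; rw [Finset.sum_comm]
    rw [Finset.sum_comm]
    refine Finset.sum_congr rfl fun σ _ => Finset.sum_congr rfl fun i _ => ?_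
    simp [Equiv.Perm.permMatrix, PEquiv.toMatrix_apply, Equiv.toPEquiv_apply]
    ring
  rw [h, ← one_mul (∑ k, p k * X k), ← hw1, Finset.sum_mul]
  exact Finset.sum_le_sum fun σ _ =>
    mul_le_mul_of_nonneg_left (hp.antivary hX).sum_mul_le_sum_comp_perm_mul (hw0 σ)

lemma sum_mul_le_sum_inner {n : ℕ} {p X : Fin n → ℝ} (hp : Antitone p) (hX : Monotone X)
    (x u : OrthonormalBasis (Fin n) ℂ (Ket (Fin n))) :
    ∑ k, p k * X k ≤ ∑ k, p k * ∑ i, X i * ‖inner ℂ (x i) (u k)‖ ^ 2 := by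
  have hM : (Matrix.of fun i k => ‖inner ℂ (x i) (u k)‖ ^ 2) ∈ doublyStochastic ℝ (Fin n) := by
    rw [mem_doublyStochastic_iff_sum]
    refine ⟨fun i j => sq_nonneg _, fun i => ?_, fun k => ?_⟩
    · simpa [(x.orthonormal.1 i)] using u.sum_sq_norm_inner_left (x i)
    · simpa [(u.orthonormal.1 k)] using x.sum_sq_norm_inner_right (u k)
  simpa only [Matrix.of_apply] using sum_mul_le_sum_doublyStochastic hp hX hM

/-- Padding the weights by zeros makes the problem on the larger factor square, so that the doubly
stochastic bound applies to it. -/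
lemma sum_castLE_extend {m n : ℕ} (h : m ≤ n) (p : Fin m → ℝ) (f : Fin n → ℝ) :
    ∑ j : Fin n, (if hj : j.val < m then p ⟨j, hj⟩ else 0) * f j =
      ∑ k, p k * f (Fin.castLE h k) := by
  symm
  refine Finset.sum_of_injOn (Fin.castLE h) (Fin.castLE_injective h).injOn (by simp) ?_ ?_
  · intro j _ hj
    have : ¬ j.val < m := fun hjm => hj ⟨⟨j, hjm⟩, by simp, rfl⟩
    simp [this]
  · intro k _
    simp

lemma sum_mul_le_energy_schmidtKet {NA NB : ℕ} (h : NA ≤ NB) {A : Fin NA → ℝ} {B : Fin NB → ℝ}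
    (hA : Monotone A) (hB : Monotone B)
    (a u : OrthonormalBasis (Fin NA) ℂ (Ket (Fin NA)))
    (b v : OrthonormalBasis (Fin NB) ℂ (Ket (Fin NB))) {p : Fin NA → ℝ} (hp : Antitone p)
    (hp0 : ∀ k, 0 ≤ p k) :
    ∑ k, p k * lowE h A B k ≤ energy (totalHamiltonian (hamiltonian A a) (hamiltonian B b))
      (schmidtKet (fun k => Real.sqrt (p k)) u (fun k => v (Fin.castLE h k))) := by
  have hv : Orthonormal ℂ fun k => v (Fin.castLE h k) :=
    v.orthonormal.comp _ (Fin.castLE_injective h)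
  rw [energy_schmidtKet A B a b _ u.orthonormal hv]
  simp only [lowE, mul_add, Finset.sum_add_distrib, Real.sq_sqrt (hp0 _)]
  refine add_le_add (sum_mul_le_sum_inner hp hA a u) ?_
  rw [← sum_castLE_extend h p B,
    ← sum_castLE_extend h p fun k => ∑ j, B j * ‖inner ℂ (b j) (v k)‖ ^ 2]
  -- The padded weights are still decreasing because `p` is nonnegative.
  refine sum_mul_le_sum_inner (fun i j hij => ?_) hB b v
  have hij' : i.val ≤ j.val := hij
  split_ifs with h1 h2 h2
  · exact hp hij'
  · omega
  · exact hp0 _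
  · exact le_rfl

/-! ### Gibbs weights -/

section Gibbs

open Filter Topology

variable {N : ℕ} (E : Fin N → ℝ)

/-- The Gibbs weights `exp (-β E_i) / Z_g(β)`. -/
noncomputable def gibbs (β : ℝ) (i : Fin N) : ℝ := Real.exp (-β * E i) / Zg E β

lemma Zg_pos [NeZero N] (β : ℝ) : 0 < Zg E β :=
  Finset.sum_pos (fun _ _ => Real.exp_pos _) Finset.univ_nonempty

lemma gibbs_pos [NeZero N] (β : ℝ) (i : Fin N) : 0 < gibbs E β i :=
  div_pos (Real.exp_pos _) (Zg_pos E β)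

lemma sum_gibbs [NeZero N] (β : ℝ) : ∑ i, gibbs E β i = 1 := by
  simp only [gibbs, ← Finset.sum_div]
  exact div_self (Zg_pos E β).ne'

lemma log_gibbs [NeZero N] (β : ℝ) (i : Fin N) :
    Real.log (gibbs E β i) = -β * E i - Real.log (Zg E β) := by
  rw [gibbs, Real.log_div (Real.exp_pos _).ne' (Zg_pos E β).ne', Real.log_exp]

lemma hasDerivAt_log_Zg [NeZero N] (β : ℝ) :
    HasDerivAt (fun x => Real.log (Zg E x)) (-∑ i, gibbs E β i * E i) β := by
  have h : HasDerivAt (Zg E) (∑ i, Real.exp (-β * E i) * (-1 * E i)) β :=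
    HasDerivAt.fun_sum fun i _ => ((hasDerivAt_id β).neg.mul_const (E i)).exp
  convert h.log (Zg_pos E β).ne' using 1
  rw [Finset.sum_div, ← Finset.sum_neg_distrib]
  exact Finset.sum_congr rfl fun i _ => by rw [gibbs]; ring

lemma sum_negMulLog_gibbs [NeZero N] (β : ℝ) :
    ∑ i, Real.negMulLog (gibbs E β i) =
      β * ∑ i, gibbs E β i * E i + Real.log (Zg E β) := by
  have h : ∀ i, Real.negMulLog (gibbs E β i) =
      β * (gibbs E β i * E i) + gibbs E β i * Real.log (Zg E β) := by
    intro i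
    rw [Real.negMulLog, log_gibbs]
    ring
  simp only [h, Finset.sum_add_distrib, ← Finset.mul_sum, ← Finset.sum_mul, sum_gibbs, one_mul]

lemma thermalEntropy_Zg [NeZero N] (β : ℝ) :
    thermalEntropy (Zg E) β = ∑ i, Real.negMulLog (gibbs E β i) := by
  rw [thermalEntropy, (hasDerivAt_log_Zg E β).deriv, sum_negMulLog_gibbs]
  ring

lemma thermalEntropy_Zg_zero : thermalEntropy (Zg E) 0 = Real.log N := by
  simp [thermalEntropy, Zg]

/-- This is `ln x ≤ x - 1` at `x = gibbs E β i / p`, multiplied by `p`. The correction `gibbs E β i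
- p` disappears on summing, both families having total 1. -/
lemma negMulLog_le_gibbs [NeZero N] (β : ℝ) (i : Fin N) {p : ℝ} (hp : 0 ≤ p) :
    Real.negMulLog p ≤ β * (p * E i) + p * Real.log (Zg E β) + (gibbs E β i - p) := by
  rcases hp.eq_or_lt with rfl | hp
  · simpa using (gibbs_pos E β i).le
  · have h := Real.log_le_sub_one_of_pos (div_pos (gibbs_pos E β i) hp)
    rw [Real.log_div (gibbs_pos E β i).ne' hp.ne', log_gibbs] at h
    have h' := mul_le_mul_of_nonneg_left h hp.le
    rw [mul_sub p (_ / _), mul_div_cancel₀ _ hp.ne'] at h'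
    rw [Real.negMulLog]
    linarith

lemma negMulLog_lt_gibbs [NeZero N] (β : ℝ) (i : Fin N) {p : ℝ} (hp : 0 < p)
    (hne : p ≠ gibbs E β i) :
    Real.negMulLog p < β * (p * E i) + p * Real.log (Zg E β) + (gibbs E β i - p) := by
  have h := Real.log_lt_sub_one_of_pos (div_pos (gibbs_pos E β i) hp)
    (fun h => hne ((div_eq_one_iff_eq hp.ne').1 h).symm)
  rw [Real.log_div (gibbs_pos E β i).ne' hp.ne', log_gibbs] at h
  have h' := mul_lt_mul_of_pos_left h hp
  rw [mul_sub p (_ / _), mul_div_cancel₀ _ hp.ne'] at h'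
  rw [Real.negMulLog]
  linarith

lemma sum_gibbs_bound [NeZero N] (β : ℝ) {p : Fin N → ℝ} (hp : ∑ i, p i = 1) :
    ∑ i, (β * (p i * E i) + p i * Real.log (Zg E β) + (gibbs E β i - p i)) =
      β * ∑ i, p i * E i + Real.log (Zg E β) := by
  simp only [Finset.sum_add_distrib, Finset.sum_sub_distrib, ← Finset.mul_sum, ← Finset.sum_mul,
    sum_gibbs, hp]
  ring

/-- The Gibbs variational principle. -/
lemma sum_negMulLog_le [NeZero N] (β : ℝ) {p : Fin N → ℝ} (hp0 : ∀ i, 0 ≤ p i)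
    (hp : ∑ i, p i = 1) :
    ∑ i, Real.negMulLog (p i) ≤ β * ∑ i, p i * E i + Real.log (Zg E β) := by
  rw [← sum_gibbs_bound E β hp]
  exact Finset.sum_le_sum fun i _ => negMulLog_le_gibbs E β i (hp0 i)

lemma sum_negMulLog_lt [NeZero N] (β : ℝ) {p : Fin N → ℝ} (hp0 : ∀ i, 0 < p i)
    (hp : ∑ i, p i = 1) (hne : p ≠ gibbs E β) :
    ∑ i, Real.negMulLog (p i) < β * ∑ i, p i * E i + Real.log (Zg E β) := by
  rw [← sum_gibbs_bound E β hp]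
  obtain ⟨i, hi⟩ := Function.ne_iff.1 hne
  exact Finset.sum_lt_sum (fun i _ => negMulLog_le_gibbs E β i (hp0 i).le)
    ⟨i, Finset.mem_univ i, negMulLog_lt_gibbs E β i (hp0 i) hi⟩

variable {E}

/-- The log-ratio of the weights at `i` and `j` is `-β (E i - E j)`, which recovers `β` as soon as
two energies differ. -/
lemma gibbs_injective [NeZero N] (hE : ¬ ∀ i j, E i = E j) : Function.Injective (gibbs E) := by
  intro β γ h
  by_contra hne
  refine hE fun i j => ?_
  have hi := congrArg Real.log (congrFun h i)
  have hj := congrArg Real.log (congrFun h j)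
  rw [log_gibbs, log_gibbs] at hi hj
  have : (β - γ) * (E i - E j) = 0 := by linarith
  rcases mul_eq_zero.1 this with h | h
  · exact absurd (sub_eq_zero.1 h) hne
  · exact sub_eq_zero.1 h

/-- Test the strict variational principle at each parameter against the Gibbs weights of the other.
Equal entropies would give both `γ (U - V) > 0` and `β (V - U) > 0`, impossible for `0 ≤ β < γ`. -/
lemma thermalEntropy_Zg_injOn [NeZero N] (hE : ¬ ∀ i j, E i = E j) :
    Set.InjOn (thermalEntropy (Zg E)) (Set.Ici 0) := by
  intro β hβ γ hγ h
  by_contra hne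
  wlog hlt : β < γ generalizing β γ
  · exact this hγ hβ h.symm (Ne.symm hne) (lt_of_le_of_ne (not_lt.1 hlt) (Ne.symm hne))
  have h1 := sum_negMulLog_lt E γ (gibbs_pos E β) (sum_gibbs E β)
    fun h => hne (gibbs_injective hE h)
  have h2 := sum_negMulLog_lt E β (gibbs_pos E γ) (sum_gibbs E γ)
    fun h => hne (gibbs_injective hE h).symm
  rw [thermalEntropy_Zg, thermalEntropy_Zg] at h
  have h3 := sum_negMulLog_gibbs E β
  have h4 := sum_negMulLog_gibbs E γ
  set U := ∑ i, gibbs E β i * E i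
  set V := ∑ i, gibbs E γ i * E i
  have hβ' : 0 ≤ β := hβ
  have hγ' : 0 < γ := hβ'.trans_lt hlt
  have h5 : 0 < γ * (U - V) := by linarith
  have h6 : 0 < β * (V - U) := by linarith
  have h7 : 0 < U - V := (mul_pos_iff_of_pos_left hγ').1 h5
  nlinarith [mul_nonneg hβ' h7.le]

lemma continuous_thermalEntropy_Zg [NeZero N] : Continuous (thermalEntropy (Zg E)) := by
  have h : thermalEntropy (Zg E) = fun β => ∑ i, Real.negMulLog (gibbs E β i) :=
    funext (thermalEntropy_Zg E)
  rw [h]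
  have hZ : Continuous (Zg E) := by unfold Zg; fun_prop
  refine continuous_finsetSum _ fun i _ => Real.continuous_negMulLog.comp ?_
  exact Continuous.div (by fun_prop) hZ fun β => (Zg_pos E β).ne'

lemma groundDegeneracy_eq_card (E : Fin N → ℝ) :
    groundDegeneracy E = (Finset.univ.filter fun i => ∀ j, E i ≤ E j).card := by
  rw [groundDegeneracy, Nat.card_eq_fintype_card, Fintype.card_subtype]

lemma groundDegeneracy_pos [NeZero N] (E : Fin N → ℝ) : 0 < groundDegeneracy E := by
  obtain ⟨i, hi⟩ := Finite.exists_min E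
  rw [groundDegeneracy_eq_card, Finset.card_pos]
  exact ⟨i, by simpa using hi⟩

/-- Measuring energies from the minimum makes each Boltzmann factor converge as `β → ∞`: to 1 on the
ground indices and to 0 elsewhere. -/
lemma gibbs_shift (E : Fin N → ℝ) (m β : ℝ) : gibbs (fun i => E i - m) β = gibbs E β := by
  ext i
  have h : ∀ i, Real.exp (-β * (E i - m)) = Real.exp (β * m) * Real.exp (-β * E i) := by
    intro i
    rw [← Real.exp_add]
    ring_nf
  simp only [gibbs, Zg, h, ← Finset.mul_sum]
  exact mul_div_mul_left _ _ (Real.exp_pos _).ne'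

lemma sum_negMulLog_uniform {ι : Type*} [Fintype ι] [DecidableEq ι] {G : Finset ι}
    (hG : G.Nonempty) :
    ∑ i, Real.negMulLog ((if i ∈ G then 1 else 0) / (G.card : ℝ)) = Real.log G.card := by
  have h : ∀ i, Real.negMulLog ((if i ∈ G then 1 else 0) / (G.card : ℝ)) =
      if i ∈ G then Real.negMulLog (1 / (G.card : ℝ)) else 0 := by
    intro i
    split_ifs <;> simp
  have hc : (G.card : ℝ) ≠ 0 := by simpa using hG.ne_empty
  rw [Finset.sum_congr rfl fun i _ => h i, Finset.sum_ite_mem, Finset.univ_inter,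
    Finset.sum_const, nsmul_eq_mul, Real.negMulLog, one_div, Real.log_inv]
  field_simp

lemma tendsto_thermalEntropy_Zg [NeZero N] (E : Fin N → ℝ) :
    Tendsto (thermalEntropy (Zg E)) atTop (𝓝 (Real.log (groundDegeneracy E))) := by
  obtain ⟨m, hm⟩ := Finite.exists_min E
  set G := Finset.univ.filter fun i => ∀ j, E i ≤ E j
  have hG : G.Nonempty := ⟨m, by simpa [G] using hm⟩
  have hexp : ∀ i, Tendsto (fun β => Real.exp (-β * (E i - E m))) atTop
      (𝓝 (if i ∈ G then 1 else 0)) := by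
    intro i
    split_ifs with hi
    · have : E i = E m := le_antisymm ((Finset.mem_filter.1 hi).2 m) (hm i)
      simp [this]
    · have hlt : 0 < E i - E m := by
        refine sub_pos.2 (lt_of_le_of_ne (hm i) fun h => hi ?_)
        simpa [G, ← h] using hm
      refine Real.tendsto_exp_atBot.comp ?_
      exact (tendsto_neg_atTop_atBot).atBot_mul_const hlt
  have hZ : Tendsto (Zg fun i => E i - E m) atTop (𝓝 (G.card : ℝ)) := by
    have := tendsto_finsetSum Finset.univ fun i _ => hexp i
    rwa [Finset.sum_boole, Finset.filter_univ_mem] at this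
  have hc : (G.card : ℝ) ≠ 0 := by simpa using hG.ne_empty
  rw [groundDegeneracy_eq_card, ← sum_negMulLog_uniform hG, funext (thermalEntropy_Zg E)]
  refine tendsto_finsetSum _ fun i _ => (Real.continuous_negMulLog.tendsto _).comp ?_
  have := (hexp i).div hZ hc
  refine this.congr fun β => ?_
  rw [← gibbs_shift E (E m)]
  rfl

lemma existsUnique_thermalEntropy_Zg [NeZero N] {S : ℝ}
    (hS : Real.log (groundDegeneracy E) < S) (hS1 : S ≤ Real.log N) :
    ∃! β : ℝ, 0 ≤ β ∧ thermalEntropy (Zg E) β = S := by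
  -- For constant `E` one has `d_g = N`, and no `S` satisfies both bounds.
  have hE : ¬ ∀ i j, E i = E j := by
    intro h
    have : groundDegeneracy E = N := by
      rw [groundDegeneracy_eq_card, Finset.filter_true_of_mem fun i _ j => (h i j).le]
      simp
    rw [this] at hS
    exact absurd hS1 (not_le.2 hS)
  obtain ⟨M, hMS, hM⟩ := (((tendsto_thermalEntropy_Zg E).eventually_lt_const hS).and
    (eventually_ge_atTop 0)).exists
  obtain ⟨β, hβ, h⟩ := intermediate_value_Icc' hM continuous_thermalEntropy_Zg.continuousOn
    ⟨hMS.le, by rwa [thermalEntropy_Zg_zero]⟩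
  exact ⟨β, ⟨hβ.1, h⟩, fun γ hγ => thermalEntropy_Zg_injOn hE hγ.1 hβ.1 (hγ.2.trans h.symm)⟩

end Gibbs

/-- Weights of prescribed entropy on a finite set. -/
lemma exists_weights_entropy {ι : Type*} [Fintype ι] [DecidableEq ι] {G : Finset ι}
    (hG : G.Nonempty) {S : ℝ} (hS0 : 0 ≤ S) (hS : S ≤ Real.log G.card) :
    ∃ q : ι → ℝ, (∀ i, 0 ≤ q i) ∧ ∑ i, q i = 1 ∧ (∀ i ∉ G, q i = 0) ∧
      ∑ i, Real.negMulLog (q i) = S := by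
  obtain ⟨m, hm⟩ := hG
  -- The segment from the point mass at `m` to the uniform weights on `G`: the entropy runs from 0
  -- to `ln |G|`, and the intermediate value theorem picks `t`.
  set q : ℝ → ι → ℝ := fun t i =>
    (1 - t) * (if i = m then 1 else 0) + t * ((if i ∈ G then 1 else 0) / (G.card : ℝ))
  have hcont : Continuous fun t => ∑ i, Real.negMulLog (q t i) :=
    continuous_finsetSum _ fun i _ => Real.continuous_negMulLog.comp (by fun_prop)
  have h0 : ∑ i, Real.negMulLog (q 0 i) = 0 := by
    refine Finset.sum_eq_zero fun i _ => ?_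
    by_cases hi : i = m <;> simp [q, hi]
  have h1 : ∑ i, Real.negMulLog (q 1 i) = Real.log G.card := by
    simpa [q] using sum_negMulLog_uniform ⟨m, hm⟩
  obtain ⟨t, ht, h⟩ := intermediate_value_Icc zero_le_one hcont.continuousOn
    (show S ∈ Set.Icc _ _ from ⟨by simpa [h0] using hS0, by simpa [h1] using hS⟩)
  have hc : (G.card : ℝ) ≠ 0 := by simpa using Finset.ne_empty_of_mem hm
  refine ⟨q t, fun i => ?_, ?_, fun i hi => ?_, h⟩
  · have := sub_nonneg.2 ht.2
    have := ht.1
    simp only [q]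
    split_ifs <;> positivity
  · simp only [q, Finset.sum_add_distrib, ← Finset.mul_sum, ← Finset.sum_div]
    simp [hc]
  · have : i ≠ m := fun h => hi (h ▸ hm)
    simp [q, hi, this]

/-! ### Lower bounds -/

section Minimum

variable {NA NB : ℕ} {h : NA ≤ NB} {A : Fin NA → ℝ} {B : Fin NB → ℝ}
  {a : OrthonormalBasis (Fin NA) ℂ (Ket (Fin NA))}
  {b : OrthonormalBasis (Fin NB) ℂ (Ket (Fin NB))}

lemma orthonormal_castLE (h : NA ≤ NB) (b : OrthonormalBasis (Fin NB) ℂ (Ket (Fin NB))) :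
    Orthonormal ℂ fun k => b (Fin.castLE h k) :=
  b.orthonormal.comp _ (Fin.castLE_injective h)

lemma schmidtKet_mem_pureStates {q : Fin NA → ℝ} (hq0 : ∀ i, 0 ≤ q i) (hq : ∑ i, q i = 1)
    {v : Fin NA → Ket (Fin NB)} (hv : Orthonormal ℂ v) :
    schmidtKet (fun i => Real.sqrt (q i)) a v ∈
      pureStates (Fin NA) (Fin NB) (∑ i, Real.negMulLog (q i)) := by
  refine ⟨?_, ?_⟩
  · rw [← sq_eq_sq₀ (norm_nonneg _) zero_le_one, norm_sq_schmidtKet _ a.orthonormal hv]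
    simp [Real.sq_sqrt (hq0 _), hq]
  · rw [entanglementEntropy_schmidtKet _ _ hv]
    simp [Real.sq_sqrt (hq0 _)]

lemma sum_mul_norm_sq_inner_basis {ι : Type} [Fintype ι] (x : OrthonormalBasis ι ℂ (Ket ι))
    (X : ι → ℝ) (k : ι) : ∑ i, X i * ‖inner ℂ (x i) (x k)‖ ^ 2 = X k := by
  classical
  rw [Finset.sum_eq_single k]
  · simp
  · intro i _ hi
    simp [x.orthonormal.2 hi]
  · simp

lemma energy_schmidtKet_basis {q : Fin NA → ℝ} (hq0 : ∀ i, 0 ≤ q i) :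
    energy (totalHamiltonian (hamiltonian A a) (hamiltonian B b))
      (schmidtKet (fun i => Real.sqrt (q i)) a (fun i => b (Fin.castLE h i))) =
      ∑ i, q i * lowE h A B i := by
  rw [energy_schmidtKet A B a b _ a.orthonormal (orthonormal_castLE h b)]
  simp only [sum_mul_norm_sq_inner_basis, Real.sq_sqrt (hq0 _), lowE, mul_add,
    Finset.sum_add_distrib]

lemma psiG_eq_schmidtKet (h : NA ≤ NB) (A : Fin NA → ℝ) (B : Fin NB → ℝ)
    (a : OrthonormalBasis (Fin NA) ℂ (Ket (Fin NA)))
    (b : OrthonormalBasis (Fin NB) ℂ (Ket (Fin NB))) (β : ℝ) :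
    psiG h A B a b β = schmidtKet (fun i => Real.sqrt (gibbs (lowE h A B) β i)) a
      (fun i => b (Fin.castLE h i)) := by
  rw [psiG, schmidtKet, Finset.smul_sum]
  refine Finset.sum_congr rfl fun i _ => ?_
  rw [smul_smul, ← Complex.ofReal_mul, gibbs, Real.sqrt_div (Real.exp_pos _).le,
    ← Real.exp_half, one_div_mul_eq_div]
  congr 4
  ring

/-- The entropy of entanglement is bounded by the free energy functional. -/
lemma entropy_le_energy [NeZero NA] (h : NA ≤ NB) (hA : Monotone A) (hB : Monotone B) {S β : ℝ}
    (hβ : 0 ≤ β) {ψ : Ket (Fin NA × Fin NB)} (hψ : ψ ∈ pureStates (Fin NA) (Fin NB) S) :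
    S ≤ β * energy (totalHamiltonian (hamiltonian A a) (hamiltonian B b)) ψ +
      Real.log (Zg (lowE h A B) β) := by
  obtain ⟨p, u, v, hp, hp0, rfl⟩ := exists_schmidt h ψ
  obtain ⟨h1, h2⟩ := hψ
  have hp1 : ∑ i, p i = 1 := by
    have := norm_sq_schmidtKet (fun k => Real.sqrt (p k)) u.orthonormal (orthonormal_castLE h v)
    rw [h1] at this
    simpa [Real.sq_sqrt (hp0 _)] using this.symm
  rw [entanglementEntropy_schmidtKet _ _ (orthonormal_castLE h v)] at h2
  simp only [Real.sq_sqrt (hp0 _)] at h2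
  have h3 := sum_negMulLog_le (lowE h A B) β hp0 hp1
  have h4 := mul_le_mul_of_nonneg_left
    (sum_mul_le_energy_schmidtKet h hA hB a u b v hp hp0) hβ
  linarith

open Filter Topology in
lemma nonneg_of_hasDerivAt_of_min {f : ℝ → ℝ} {f' x : ℝ} (hf : HasDerivAt f f' x)
    (hx : ∀ y, x ≤ y → f x ≤ f y) : 0 ≤ f' := by
  have h := (hasDerivAt_iff_tendsto_slope.1 hf).mono_left (nhdsGT_le_nhdsNE x)
  refine ge_of_tendsto h ?_
  filter_upwards [self_mem_nhdsWithin] with y hy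
  have hy : x < y := hy
  rw [slope_def_field]
  exact div_nonneg (sub_nonneg.2 (hx y hy.le)) (sub_nonneg.2 hy.le)

/-- For `β > 0`, compare the two free-energy relations and divide by `β`. At `β = 0` they do not
involve the energy. Instead, `x * e + ln Z(x)` is at least `S` for all `x ≥ 0`, with equality at `x
= 0`, so its derivative there, `e` minus the Gibbs mean energy, is nonnegative. -/
lemma gibbs_energy_le [NeZero NA] (h : NA ≤ NB) (hA : Monotone A) (hB : Monotone B) {S β : ℝ}
    (hβ : 0 ≤ β) (hS : thermalEntropy (Zg (lowE h A B)) β = S)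
    {ψ : Ket (Fin NA × Fin NB)} (hψ : ψ ∈ pureStates (Fin NA) (Fin NB) S) :
    ∑ i, gibbs (lowE h A B) β i * lowE h A B i ≤
      energy (totalHamiltonian (hamiltonian A a) (hamiltonian B b)) ψ := by
  set e := energy (totalHamiltonian (hamiltonian A a) (hamiltonian B b)) ψ
  rw [thermalEntropy_Zg, sum_negMulLog_gibbs] at hS
  rcases hβ.eq_or_lt with rfl | hβ
  · have hd : HasDerivAt (fun x => x * e + Real.log (Zg (lowE h A B) x))
        (1 * e + -∑ i, gibbs (lowE h A B) 0 i * lowE h A B i) 0 :=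
      ((hasDerivAt_id 0).mul_const e).add (hasDerivAt_log_Zg _ 0)
    have := nonneg_of_hasDerivAt_of_min hd fun y hy => by
      have := entropy_le_energy (a := a) (b := b) h hA hB hy hψ
      linarith
    linarith
  · have := entropy_le_energy (a := a) (b := b) h hA hB hβ.le hψ
    exact le_of_mul_le_mul_left (by linarith) hβ

lemma minimum_above [NeZero NA] (h : NA ≤ NB) (hA : Monotone A) (hB : Monotone B)
    {H : Matrix (Fin NA × Fin NB) (Fin NA × Fin NB) ℂ}
    (hH : H = totalHamiltonian (hamiltonian A a) (hamiltonian B b)) {S β : ℝ}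
    (hβ : 0 ≤ β) (hS : thermalEntropy (Zg (lowE h A B)) β = S) :
    psiG h A B a b β ∈ pureStates (Fin NA) (Fin NB) S ∧
    IsMinOn (energy H) (pureStates (Fin NA) (Fin NB) S) (psiG h A B a b β) ∧
    energy H (psiG h A B a b β) = -deriv (fun x => Real.log (Zg (lowE h A B) x)) β := by
  have hg0 := fun i => (gibbs_pos (lowE h A B) β i).le
  rw [psiG_eq_schmidtKet, (hasDerivAt_log_Zg _ β).deriv, neg_neg, hH]
  refine ⟨?_, ?_, energy_schmidtKet_basis hg0⟩
  · rw [← hS, thermalEntropy_Zg]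
    exact schmidtKet_mem_pureStates hg0 (sum_gibbs _ β) (orthonormal_castLE h b)
  · intro ψ hψ
    change energy _ _ ≤ energy _ _
    rw [energy_schmidtKet_basis hg0]
    exact gibbs_energy_le h hA hB hβ hS hψ

lemma minimum_below (hNA : 0 < NA) (h : NA ≤ NB) (hA : Monotone A) (hB : Monotone B)
    {H : Matrix (Fin NA × Fin NB) (Fin NA × Fin NB) ℂ}
    (hH : H = totalHamiltonian (hamiltonian A a) (hamiltonian B b)) {S : ℝ}
    (hS0 : 0 ≤ S) (hS : S ≤ Real.log (groundDegeneracy (lowE h A B))) :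
    IsLeast (energy H '' pureStates (Fin NA) (Fin NB) S)
      (A ⟨0, hNA⟩ + B ⟨0, lt_of_lt_of_le hNA h⟩) ∧
    (∃ ψ ∈ pureStates (Fin NA) (Fin NB) S,
      ψ ∈ Submodule.span ℂ {φ | ∃ i : Fin NA, (∀ j, lowE h A B i ≤ lowE h A B j) ∧
        φ = prodKet (a i) (b (Fin.castLE h i))}) ∧
    ∀ ψ ∈ pureStates (Fin NA) (Fin NB) S,
      energy H ψ = A ⟨0, hNA⟩ + B ⟨0, lt_of_lt_of_le hNA h⟩ →
      InEigenspace H (A ⟨0, hNA⟩ + B ⟨0, lt_of_lt_of_le hNA h⟩) ψ := by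
  subst hH
  have : NeZero NA := ⟨hNA.ne'⟩
  set E₀ := A ⟨0, hNA⟩ + B ⟨0, lt_of_lt_of_le hNA h⟩ with hE₀
  obtain ⟨e, -, he⟩ := exists_totalHamiltonian_eigenbasis A B a b
  have hE : ∀ p : Fin NA × Fin NB, E₀ ≤ A p.1 + B p.2 := fun p =>
    add_le_add (hA (Nat.zero_le _)) (hB (Nat.zero_le _))
  set G := Finset.univ.filter fun i => ∀ j, lowE h A B i ≤ lowE h A B j
  have hG : G.Nonempty := Finset.card_pos.1 (groundDegeneracy_eq_card _ ▸ groundDegeneracy_pos _)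
  -- Index 0 attains `E₀`, so the minimum of `lowE` is the lowest eigenvalue of the whole of `H`.
  have hGE : ∀ i ∈ G, lowE h A B i = E₀ := fun i hi =>
    le_antisymm ((Finset.mem_filter.1 hi).2 ⟨0, hNA⟩) (hE (i, Fin.castLE h i))
  rw [groundDegeneracy_eq_card] at hS
  obtain ⟨q, hq0, hq1, hqG, rfl⟩ := exists_weights_entropy hG hS0 hS
  have hmem := schmidtKet_mem_pureStates (a := a) hq0 hq1 (orthonormal_castLE h b)
  refine ⟨⟨⟨_, hmem, ?_⟩, ?_⟩, ⟨_, hmem, ?_⟩, fun ψ hψ h =>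
    inEigenspace_of_energy_eq he hE hψ.1 h⟩
  · rw [energy_schmidtKet_basis hq0, ← one_mul E₀, ← hq1, Finset.sum_mul]
    refine Finset.sum_congr rfl fun i _ => ?_
    by_cases hi : i ∈ G
    · rw [hGE i hi]
    · simp [hqG i hi]
  · rintro _ ⟨ψ, hψ, rfl⟩
    exact le_energy he hE hψ.1
  · refine Submodule.sum_mem _ fun i _ => ?_
    by_cases hi : i ∈ G
    · exact Submodule.smul_mem _ _ (Submodule.subset_span ⟨i, (Finset.mem_filter.1 hi).2, rfl⟩)
    · simp [hqG i hi]

end Minimum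

/-! ### Order reversal -/

section Reversal

variable {NA NB : ℕ}

/-- The spectrum of `-X`, in increasing order. -/
def revNeg {N : ℕ} (X : Fin N → ℝ) (i : Fin N) : ℝ := -X i.rev

lemma monotone_revNeg {N : ℕ} {X : Fin N → ℝ} (hX : Monotone X) : Monotone (revNeg X) :=
  fun _ _ hij => neg_le_neg (hX (Fin.rev_le_rev.2 hij))

lemma hamiltonian_revNeg {N : ℕ} (X : Fin N → ℝ)
    (x : OrthonormalBasis (Fin N) ℂ (Ket (Fin N))) :
    hamiltonian (revNeg X) (x.reindex Fin.revPerm) = -hamiltonian X x := by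
  rw [hamiltonian, hamiltonian, ← Finset.sum_neg_distrib, ← Equiv.sum_comp Fin.revPerm]
  refine Finset.sum_congr rfl fun i _ => ?_
  simp [revNeg]

lemma totalHamiltonian_neg {ι κ : Type} [DecidableEq ι] [DecidableEq κ] (HA : Matrix ι ι ℂ)
    (HB : Matrix κ κ ℂ) : totalHamiltonian (-HA) (-HB) = -totalHamiltonian HA HB := by
  ext p q
  simp [totalHamiltonian, Matrix.kronecker]
  ring

lemma energy_neg {ι : Type} [Fintype ι] (H : Matrix ι ι ℂ) (ψ : Ket ι) :
    energy (-H) ψ = -energy H ψ := by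
  simp [energy, Matrix.neg_mulVec]

lemma inEigenspace_neg {ι : Type} [Fintype ι] {H : Matrix ι ι ℂ} {E : ℝ} {ψ : Ket ι} :
    InEigenspace (-H) (-E) ψ ↔ InEigenspace H E ψ := by
  simp [InEigenspace, Matrix.neg_mulVec]

/-- Reversal sends the first `NA` of the `NB` levels to the last `NA`, which is where the offset `NB
- NA` comes from. -/
lemma castLE_rev (h : NA ≤ NB) (i : Fin NA) : (Fin.castLE h i).rev = shift h i.rev := by
  ext
  simp only [Fin.val_rev, Fin.val_castLE, shift]
  omega

lemma lowE_revNeg (h : NA ≤ NB) (A : Fin NA → ℝ) (B : Fin NB → ℝ) :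
    lowE h (revNeg A) (revNeg B) = revNeg (highE h A B) := by
  ext i
  simp only [lowE, highE, revNeg, castLE_rev]
  ring

lemma Zg_revNeg {N : ℕ} (E : Fin N → ℝ) : Zg (revNeg E) = Ze E := by
  ext β
  rw [Zg, Ze, ← Equiv.sum_comp Fin.revPerm]
  simp [revNeg]

lemma groundDegeneracy_revNeg {N : ℕ} (E : Fin N → ℝ) :
    groundDegeneracy (revNeg E) = topDegeneracy E := by
  refine Nat.card_congr (Fin.revPerm.subtypeEquiv fun i => ?_)
  simp only [revNeg, neg_le_neg_iff, Fin.revPerm_apply]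
  exact (Fin.rev_surjective.forall (p := fun j => E j ≤ E i.rev)).symm

lemma psiG_revNeg (h : NA ≤ NB) (A : Fin NA → ℝ) (B : Fin NB → ℝ)
    (a : OrthonormalBasis (Fin NA) ℂ (Ket (Fin NA)))
    (b : OrthonormalBasis (Fin NB) ℂ (Ket (Fin NB))) (β : ℝ) :
    psiG h (revNeg A) (revNeg B) (a.reindex Fin.revPerm) (b.reindex Fin.revPerm) β =
      psiE h A B a b β := by
  rw [psiG, psiE, lowE_revNeg, Zg_revNeg, ← Equiv.sum_comp Fin.revPerm]
  congr 1
  refine Finset.sum_congr rfl fun i _ => ?_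
  simp only [revNeg, OrthonormalBasis.reindex_apply, Fin.revPerm_symm, Fin.revPerm_apply,
    castLE_rev, Fin.rev_rev]
  congr 3
  ring_nf

end Reversal

end EnergyBounds

theorem mainTheorem2 (NA NB : ℕ) (hNA : 0 < NA) (hAB : NA ≤ NB)
    (A : Fin NA → ℝ) (B : Fin NB → ℝ) (hA : Monotone A) (hB : Monotone B)
    (a : OrthonormalBasis (Fin NA) ℂ (EnergyBounds.Ket (Fin NA)))
    (b : OrthonormalBasis (Fin NB) ℂ (EnergyBounds.Ket (Fin NB)))
    (H : Matrix (Fin NA × Fin NB) (Fin NA × Fin NB) ℂ)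
    (hH : H = EnergyBounds.totalHamiltonian
      (EnergyBounds.hamiltonian A a) (EnergyBounds.hamiltonian B b))
    (S : ℝ) (hS0 : 0 ≤ S) (hS1 : S ≤ Real.log NA) :
    -- minimum energy, entropy above `ln d_g`
    (Real.log (EnergyBounds.groundDegeneracy (EnergyBounds.lowE hAB A B)) < S →
      (∃! β : ℝ, 0 ≤ β ∧
        EnergyBounds.thermalEntropy (EnergyBounds.Zg (EnergyBounds.lowE hAB A B)) β = S) ∧
      ∀ β : ℝ, 0 ≤ β →
        EnergyBounds.thermalEntropy (EnergyBounds.Zg (EnergyBounds.lowE hAB A B)) β = S →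
        EnergyBounds.psiG hAB A B a b β ∈ EnergyBounds.pureStates (Fin NA) (Fin NB) S ∧
        IsMinOn (EnergyBounds.energy H) (EnergyBounds.pureStates (Fin NA) (Fin NB) S)
          (EnergyBounds.psiG hAB A B a b β) ∧
        EnergyBounds.energy H (EnergyBounds.psiG hAB A B a b β) =
          -deriv (fun x => Real.log (EnergyBounds.Zg (EnergyBounds.lowE hAB A B) x)) β) ∧
    -- minimum energy, entropy at most `ln d_g`
    (S ≤ Real.log (EnergyBounds.groundDegeneracy (EnergyBounds.lowE hAB A B)) →
      IsLeast (EnergyBounds.energy H '' EnergyBounds.pureStates (Fin NA) (Fin NB) S)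
        (A ⟨0, hNA⟩ + B ⟨0, lt_of_lt_of_le hNA hAB⟩) ∧
      (∃ ψ ∈ EnergyBounds.pureStates (Fin NA) (Fin NB) S,
        ψ ∈ Submodule.span ℂ {φ | ∃ i : Fin NA,
          (∀ j, EnergyBounds.lowE hAB A B i ≤ EnergyBounds.lowE hAB A B j) ∧
          φ = EnergyBounds.prodKet (a i) (b (Fin.castLE hAB i))}) ∧
      ∀ ψ ∈ EnergyBounds.pureStates (Fin NA) (Fin NB) S,
        EnergyBounds.energy H ψ = A ⟨0, hNA⟩ + B ⟨0, lt_of_lt_of_le hNA hAB⟩ →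
        EnergyBounds.InEigenspace H (A ⟨0, hNA⟩ + B ⟨0, lt_of_lt_of_le hNA hAB⟩) ψ) ∧
    -- maximum energy, entropy above `ln d_e`
    (Real.log (EnergyBounds.topDegeneracy (EnergyBounds.highE hAB A B)) < S →
      (∃! β : ℝ, 0 ≤ β ∧
        EnergyBounds.thermalEntropy (EnergyBounds.Ze (EnergyBounds.highE hAB A B)) β = S) ∧
      ∀ β : ℝ, 0 ≤ β →
        EnergyBounds.thermalEntropy (EnergyBounds.Ze (EnergyBounds.highE hAB A B)) β = S →
        EnergyBounds.psiE hAB A B a b β ∈ EnergyBounds.pureStates (Fin NA) (Fin NB) S ∧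
        IsMaxOn (EnergyBounds.energy H) (EnergyBounds.pureStates (Fin NA) (Fin NB) S)
          (EnergyBounds.psiE hAB A B a b β) ∧
        EnergyBounds.energy H (EnergyBounds.psiE hAB A B a b β) =
          deriv (fun x => Real.log (EnergyBounds.Ze (EnergyBounds.highE hAB A B) x)) β) ∧
    -- maximum energy, entropy at most `ln d_e`
    (S ≤ Real.log (EnergyBounds.topDegeneracy (EnergyBounds.highE hAB A B)) →
      IsGreatest (EnergyBounds.energy H '' EnergyBounds.pureStates (Fin NA) (Fin NB) S)
        (A ⟨NA - 1, Nat.sub_lt hNA Nat.one_pos⟩ +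
          B ⟨NB - 1, Nat.sub_lt (lt_of_lt_of_le hNA hAB) Nat.one_pos⟩) ∧
      (∃ ψ ∈ EnergyBounds.pureStates (Fin NA) (Fin NB) S,
        ψ ∈ Submodule.span ℂ {φ | ∃ i : Fin NA,
          (∀ j, EnergyBounds.highE hAB A B j ≤ EnergyBounds.highE hAB A B i) ∧
          φ = EnergyBounds.prodKet (a i) (b (EnergyBounds.shift hAB i))}) ∧
      ∀ ψ ∈ EnergyBounds.pureStates (Fin NA) (Fin NB) S,
        EnergyBounds.energy H ψ = A ⟨NA - 1, Nat.sub_lt hNA Nat.one_pos⟩ +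
          B ⟨NB - 1, Nat.sub_lt (lt_of_lt_of_le hNA hAB) Nat.one_pos⟩ →
        EnergyBounds.InEigenspace H (A ⟨NA - 1, Nat.sub_lt hNA Nat.one_pos⟩ +
          B ⟨NB - 1, Nat.sub_lt (lt_of_lt_of_le hNA hAB) Nat.one_pos⟩) ψ) := by
  have : NeZero NA := ⟨hNA.ne'⟩
  -- `-H` is again a sum of local Hamiltonians with increasing spectra, so the results on minima
  -- apply to it.
  have hH' : -H = EnergyBounds.totalHamiltonian
      (EnergyBounds.hamiltonian (EnergyBounds.revNeg A) (a.reindex Fin.revPerm))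
      (EnergyBounds.hamiltonian (EnergyBounds.revNeg B) (b.reindex Fin.revPerm)) := by
    rw [EnergyBounds.hamiltonian_revNeg, EnergyBounds.hamiltonian_revNeg,
      EnergyBounds.totalHamiltonian_neg, hH]
  have hA' := EnergyBounds.monotone_revNeg hA
  have hB' := EnergyBounds.monotone_revNeg hB
  refine ⟨fun hS => ⟨EnergyBounds.existsUnique_thermalEntropy_Zg hS hS1, fun β hβ h =>
      EnergyBounds.minimum_above hAB hA hB hH hβ h⟩,
    fun hS => EnergyBounds.minimum_below hNA hAB hA hB hH hS0 hS, fun hS => ⟨?_, ?_⟩,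
    fun hS => ?_⟩
  · rw [← EnergyBounds.groundDegeneracy_revNeg] at hS
    rw [← EnergyBounds.Zg_revNeg]
    exact EnergyBounds.existsUnique_thermalEntropy_Zg hS hS1
  · intro β hβ h
    rw [← EnergyBounds.Zg_revNeg, ← EnergyBounds.lowE_revNeg] at h ⊢
    obtain ⟨h1, h2, h3⟩ := EnergyBounds.minimum_above hAB hA' hB' hH' hβ h
    rw [EnergyBounds.psiG_revNeg] at h1 h2 h3
    refine ⟨h1, fun ψ hψ => ?_, ?_⟩
    · have := h2 hψ
      simpa [EnergyBounds.energy_neg] using this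
    · rwa [EnergyBounds.energy_neg, neg_inj] at h3
  · rw [← EnergyBounds.groundDegeneracy_revNeg, ← EnergyBounds.lowE_revNeg] at hS
    obtain ⟨h1, ⟨φ, hφ, hφs⟩, h3⟩ :=
      EnergyBounds.minimum_below hNA hAB hA' hB' hH' hS0 hS
    have hE : EnergyBounds.revNeg A ⟨0, hNA⟩ +
        EnergyBounds.revNeg B ⟨0, lt_of_lt_of_le hNA hAB⟩ =
        -(A ⟨NA - 1, Nat.sub_lt hNA Nat.one_pos⟩ +
          B ⟨NB - 1, Nat.sub_lt (lt_of_lt_of_le hNA hAB) Nat.one_pos⟩) := by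
      rw [neg_add]
      rfl
    rw [hE] at h1
    refine ⟨⟨?_, ?_⟩, ⟨φ, hφ, ?_⟩, fun ψ hψ h => ?_⟩
    · obtain ⟨ψ, hψ, h⟩ := h1.1
      exact ⟨ψ, hψ, by rwa [EnergyBounds.energy_neg, neg_inj] at h⟩
    · rintro _ ⟨ψ, hψ, rfl⟩
      have := h1.2 ⟨ψ, hψ, rfl⟩
      rwa [EnergyBounds.energy_neg, neg_le_neg_iff] at this
    · refine Submodule.span_mono ?_ hφs
      rintro _ ⟨i, hi, rfl⟩
      refine ⟨i.rev, fun j => ?_, ?_⟩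
      · have := hi j.rev
        simpa [EnergyBounds.lowE_revNeg, EnergyBounds.revNeg] using this
      · simp [EnergyBounds.castLE_rev]
    · have := h3 ψ hψ (by rw [EnergyBounds.energy_neg, h, hE])
      rwa [hE, EnergyBounds.inEigenspace_neg] at this
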